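/- Let $k\ge 4$ and let $\mathcal A=\{0,1,\dots,k-1,0',1',\dots,(k-1)'\}$ be an alphabet of $2k$ letters. Let $\xi_k:\mathcal A^*\to\mathcal A^*$ be the morphism given by $0\mapsto 01$, $\ell\mapsto \ell+1$ for $1\le \ell\le k-2$, $k-1\mapsto 0'$, and $0'\mapsto 0'1'$, $\ell'\mapsto(\ell+1)'$ for $1\le\ell\le k-2$, $(k-1)'\mapsto 0$. Let $\mathbf u_k=\xi_k^\omega(0)$ be the infinite word that has $\xi_k^n(0)$ as a prefix for every $n\in\mathbb N$. For a non-empty word $u$ and a prefix $z$ of the periodic infinite word $u^\omega=uuu\cdots$, write $z=u^r$ with $r=|z|/|u|$ (such a $z$ has period $|u|$). For an infinite word $\mathbf v$, the critical exponent is $$\mathrm E(\mathbf v)=\sup\{r\in\mathbb Q: u^r \text{ is a non-empty factor of } \mathbf v \text{ for some non-empty word } u\}\in\mathbb R\cup\{\infty\};$$ the asymptotic critical exponent is $\mathrm E^*(\mathbf v)=\infty$ if $\mathrm E(\mathbf v)=\infty$, and otherwise $$\mathrm E^*(\mathbf v)=\lim_{n\to\infty}\sup\{r\in\mathbb Q: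 u^r \text{ is a non-empty factor of } \mathbf v \text{ for some word } u \text{ with } |u|\ge n,\ u \text{ non-empty}\}.$$ Then: 1. $\mathbf u_k$ contains no overlap, that is, no factor of the form $axaxa$ with $a\in\mathcal A$ a letter and $x\in\mathcal A^*$ a (possibly empty) word. 2. $\mathbf u_k$ contains squares of unbounded length: for every $N\in\mathbb N$ there is a non-empty word $x$ with $|x|\ge N$ such that $xx$ is a factor of $\mathbf u_k$. 3. $\mathrm E(\mathbf u_k)=2$ and $\mathrm E^*(\mathbf u_k)=2$. -/

import Mathlib

namespace ThueMorseLike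

open Filter Topology

section Words

variable {A : Type*}

/-- The extension of a map from letters to words to a morphism of free monoids. -/
def extend (ψ : A → List A) (w : List A) : List A := w.flatMap ψ

/-- The sequence `ψ^ω(b)`. When `ψ` is non-erasing and `ψ(b) = b w` with `w` non-empty, the word
`ψ^n(b)` has length greater than `n`, the default value of `getD` is never used, and this is the
unique sequence having every `ψ^n(b)` as a prefix (see `getElem_iterate_eq` below). -/
def omegaPower (ψ : A → List A) (b : A) : ℕ → A :=
  fun n => ((extend ψ)^[n] [b]).getD n b

/-- The word `w` is a factor of the sequence `v`. -/
def IsFactor (w : List A) (v : ℕ → A) : Prop :=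
  ∃ j : ℕ, ∀ (i : ℕ) (hi : i < w.length), w[i] = v (j + i)

/-- An overlap is a word of the form `a x a x a` with `a` a letter and `x` a possibly empty
word. -/
def IsOverlap (w : List A) : Prop :=
  ∃ (a : A) (x : List A), w = [a] ++ x ++ [a] ++ x ++ [a]

/-- `z` is a prefix of the periodic sequence `u^ω`, where `u` is non-empty; that is,
`z = u^r` with `r = |z| / |u|`. -/
def IsFractionalPower (z u : List A) : Prop :=
  u ≠ [] ∧ ∀ i < z.length, z[i]? = u[i % u.length]?

/-- The exponents `r` such that `u^r` is a non-empty factor of `v` for some word `u` of length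
at least `n`. -/
def exponents (v : ℕ → A) (n : ℕ) : Set ℚ :=
  {r | ∃ z u : List A, z ≠ [] ∧ IsFactor z v ∧ IsFractionalPower z u ∧ n ≤ u.length ∧
    r = (z.length : ℚ) / (u.length : ℚ)}

/-- The supremum, in the extended reals, of a set of rational numbers. -/
noncomputable def extendedSup (S : Set ℚ) : EReal := ⨆ r ∈ S, (((r : ℚ) : ℝ) : EReal)

/-- The critical exponent of a sequence. (Every period is at least `1`, so the bound `0` on the
period is no restriction.) -/
noncomputable def criticalExponent (v : ℕ → A) : EReal := extendedSup (exponents v 0)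

open Classical in
/-- The asymptotic critical exponent of a sequence. The limit always exists in the extended reals,
see `tendsto_extendedSup` below. -/
noncomputable def asymptoticCriticalExponent (v : ℕ → A) : EReal :=
  if criticalExponent v = ⊤ then ⊤
  else limUnder atTop (fun n : ℕ => extendedSup (exponents v n))

theorem tendsto_extendedSup (v : ℕ → A) :
    Tendsto (fun n : ℕ => extendedSup (exponents v n)) atTop
      (𝓝 (limUnder atTop (fun n : ℕ => extendedSup (exponents v n)))) := by
  have h : Antitone (fun n : ℕ => extendedSup (exponents v n)) := by
    intro m n hmn
    refine biSup_mono ?_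
    rintro r ⟨z, u, h1, h2, h3, h4, h5⟩
    exact ⟨z, u, h1, h2, h3, hmn.trans h4, h5⟩
  exact tendsto_nhds_limUnder ⟨_, tendsto_atTop_iInf h⟩

theorem extend_append (ψ : A → List A) (w w' : List A) :
    extend ψ (w ++ w') = extend ψ w ++ extend ψ w' := by
  simp [extend]

theorem length_le_extend (ψ : A → List A) (hψ : ∀ a, ψ a ≠ []) (w : List A) :
    w.length ≤ (extend ψ w).length := by
  induction w with
  | nil => simp
  | cons a w ih =>
    have : 0 < (ψ a).length := List.length_pos_of_ne_nil (hψ a)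
    simp only [extend, List.flatMap_cons, List.length_append, List.length_cons] at ih ⊢
    omega

theorem iterate_step (ψ : A → List A) (hψ : ∀ a, ψ a ≠ []) (b : A) (w : List A)
    (hw : w ≠ []) (hb : ψ b = b :: w) (n : ℕ) :
    ∃ t : List A, t ≠ [] ∧ (extend ψ)^[n + 1] [b] = (extend ψ)^[n] [b] ++ t := by
  induction n with
  | zero => exact ⟨w, hw, by simp [extend, hb]⟩
  | succ n ih =>
    obtain ⟨t, ht, h⟩ := ih
    refine ⟨extend ψ t, ?_, ?_⟩
    · have h1 := length_le_extend ψ hψ t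
      have h2 := List.length_pos_of_ne_nil ht
      exact List.ne_nil_of_length_pos (by omega)
    · have h' := congrArg (extend ψ) h
      rw [extend_append, ← Function.iterate_succ_apply' (extend ψ),
        ← Function.iterate_succ_apply' (extend ψ)] at h'
      exact h'

theorem lt_length_iterate (ψ : A → List A) (hψ : ∀ a, ψ a ≠ []) (b : A) (w : List A)
    (hw : w ≠ []) (hb : ψ b = b :: w) (n : ℕ) : n < ((extend ψ)^[n] [b]).length := by
  induction n with
  | zero => simp
  | succ n ih =>
    obtain ⟨t, ht, h⟩ := iterate_step ψ hψ b w hw hb n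
    have := List.length_pos_of_ne_nil ht
    rw [h, List.length_append]
    omega

theorem iterate_prefix (ψ : A → List A) (hψ : ∀ a, ψ a ≠ []) (b : A) (w : List A)
    (hw : w ≠ []) (hb : ψ b = b :: w) {m n : ℕ} (hmn : m ≤ n) :
    (extend ψ)^[m] [b] <+: (extend ψ)^[n] [b] := by
  induction n, hmn using Nat.le_induction with
  | base => exact List.prefix_refl _
  | succ n _ ih =>
    obtain ⟨t, _, h⟩ := iterate_step ψ hψ b w hw hb n
    rw [h]
    exact ih.trans (List.prefix_append _ _)

/-- For a prolongable non-erasing `ψ`, every `ψ^n(b)` is a prefix of `ψ^ω(b)`. -/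
theorem getElem_iterate_eq (ψ : A → List A) (hψ : ∀ a, ψ a ≠ []) (b : A) (w : List A)
    (hw : w ≠ []) (hb : ψ b = b :: w) (n i : ℕ) (hi : i < ((extend ψ)^[n] [b]).length) :
    ((extend ψ)^[n] [b])[i] = omegaPower ψ b i := by
  have hi' := lt_length_iterate ψ hψ b w hw hb i
  rw [omegaPower, List.getD_eq_getElem _ _ hi']
  rcases le_total n i with h | h
  · exact (iterate_prefix ψ hψ b w hw hb h).getElem hi
  · exact ((iterate_prefix ψ hψ b w hw hb h).getElem hi').symm

end Words

/-- The alphabet `{0, …, k-1, 0', …, (k-1)'}`: `(ℓ, false)` is the letter `ℓ` and `(ℓ, true)` is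
the letter `ℓ'`. -/
abbrev Letter (k : ℕ) : Type := Fin k × Bool

/-- The letter `0`. -/
def zeroLetter (k : ℕ) [NeZero k] : Letter k := (0, false)

/-- The morphism `ξ_k` on letters (for `k ≥ 2`): `0 ↦ 01`, `ℓ ↦ ℓ+1` for `1 ≤ ℓ ≤ k-2`,
`k-1 ↦ 0'`, and the same with primed and unprimed letters exchanged. -/
def xi (k : ℕ) [NeZero k] : Letter k → List (Letter k) := fun a =>
  if a.1.val = 0 then [a, (Fin.ofNat k 1, a.2)]
  else if h : a.1.val + 1 < k then [(⟨a.1.val + 1, h⟩, a.2)]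
  else [(0, !a.2)]

/-- The sequence `u_k = ξ_k^ω(0)`. -/
def fixedPoint (k : ℕ) [NeZero k] : ℕ → Letter k := omegaPower (xi k) (zeroLetter k)

/-- Every `ξ_k^n(0)` is a prefix of `u_k`. -/
theorem getElem_iterate_xi_eq (k : ℕ) [NeZero k] (n i : ℕ)
    (hi : i < ((extend (xi k))^[n] [zeroLetter k]).length) :
    ((extend (xi k))^[n] [zeroLetter k])[i] = fixedPoint k i := by
  refine getElem_iterate_eq (xi k) ?_ (zeroLetter k) [(Fin.ofNat k 1, false)] (by simp) ?_ n i hi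
  · intro a
    unfold xi
    split_ifs <;> simp
  · simp [xi, zeroLetter]

end ThueMorseLike

namespace ThueMorseLike

/-! An overlap is a factor of length `2p + 1` with period `p`, so overlap-freeness says that two
occurrences of a factor at distance `p` cannot agree on `p + 1` consecutive letters
(`exists_not_same`). Extend the agreement to the left as far as possible, then desubstitute. The
images of two distinct letters begin alike only for `0` and `(k-1)'` (or `0'` and `k-1`), so the two
occurrences start at the images under `ξ^(n+1)` of such a pair (`exists_merge`).

To the right, `ξ^n(0)ξ^n(1)` is compared with `ξ^n(0)` followed by `ξ^n(0)` or `ξ^n(0')`. A mismatch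
occurs at offset `|ξ^n(0)|` in the first case and at most `2|ξ^n(0)|` in the second
(`exists_not_same_of_merge`). The letters around the pair put the two occurrences at least that far
apart (`exists_not_same_le`).

Squares come from the factor `0'0'` of the prefix `01⋯(k-1)0'0'`: its images under `ξ^n` are squares
of unbounded length. Hence every supremum defining either exponent is exactly 2. -/

/-- The sequence with letters `(x i, t i)` is fixed by the morphism `ξ_k`, and `P i` is the position
at which the image of its `i`-th letter starts. -/
structure SelfSimilar (k : ℕ) (x : ℕ → ℕ) (t : ℕ → Bool) (P : ℕ → ℕ) : Prop where
  lt : ∀ i, x i < k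
  start : x 0 = 0
  map_zero : P 0 = 0
  zero : ∀ i, x i = 0 →
    P (i + 1) = P i + 2 ∧ x (P i) = 0 ∧ t (P i) = t i ∧ x (P i + 1) = 1 ∧ t (P i + 1) = t i
  mid : ∀ i, x i ≠ 0 → x i + 1 < k → P (i + 1) = P i + 1 ∧ x (P i) = x i + 1 ∧ t (P i) = t i
  last : ∀ i, x i ≠ 0 → x i + 1 = k → P (i + 1) = P i + 1 ∧ x (P i) = 0 ∧ t (P i) = !t i

/-! ### Lengths of iterated images. -/

/-- The length of the `n`-th image under `ξ_k` of a letter with index `l`. -/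
def imageLength (k : ℕ) : ℕ → ℕ → ℕ
  | 0, _ => 1
  | n + 1, l =>
    if l = 0 then imageLength k n 0 + imageLength k n 1
    else if l + 1 < k then imageLength k n (l + 1)
    else imageLength k n 0

theorem imageLength_succ_zero (k n : ℕ) :
    imageLength k (n + 1) 0 = imageLength k n 0 + imageLength k n 1 := by
  simp [imageLength]

theorem imageLength_pos (k n l : ℕ) : 0 < imageLength k n l := by
  induction n generalizing l with
  | zero => simp [imageLength]
  | succ n ih =>
    rw [imageLength]
    split_ifs
    · have := ih 0; omega
    · exact ih _
    · exact ih _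

theorem imageLength_eq_one {k n l : ℕ} (hl : l ≠ 0) (h : n + l < k) : imageLength k n l = 1 := by
  induction n generalizing l with
  | zero => simp [imageLength]
  | succ n ih =>
    rw [imageLength, if_neg hl, if_pos (by omega)]
    exact ih (by omega) (by omega)

/-- A nonzero index climbs by one at each step and returns to `0` after exactly `k - l` steps; the
mark does not affect lengths. -/
theorem imageLength_add {k r l : ℕ} (n : ℕ) (hl : l ≠ 0) (h : r + l = k) (hr : r ≠ 0) :
    imageLength k (n + r) l = imageLength k n 0 := by
  induction r generalizing l with
  | zero => exact absurd rfl hr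
  | succ r ih =>
    rw [← add_assoc, imageLength, if_neg hl]
    split_ifs with h1
    · exact ih (by omega) (by omega) (by omega)
    · obtain rfl : r = 0 := by omega
      rfl

theorem lt_imageLength_zero (k n : ℕ) : n < imageLength k n 0 := by
  induction n with
  | zero => simp [imageLength]
  | succ n ih =>
    have := imageLength_pos k n 1
    rw [imageLength_succ_zero]
    omega

theorem imageLength_zero_le_succ (k n : ℕ) : imageLength k n 0 ≤ imageLength k (n + 1) 0 := by
  rw [imageLength_succ_zero]
  omega

/-- With `L n = |ξ^n(0)|`, the increments are `|ξ^n(1)|`, which is `1` for `n < k - 1` and `L (n -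
(k - 1))` afterwards. The inductive step thus needs only `2|ξ^n(1)| ≤ L n`, an earlier instance of
the claim once `n ≥ k - 1`. -/
theorem two_mul_imageLength_le {k : ℕ} (hk : 3 ≤ k) (n : ℕ) :
    2 * imageLength k n 0 ≤ imageLength k (n + (k - 1)) 0 := by
  induction n using Nat.strong_induction_on with
  | _ n ih =>
    cases n with
    | zero =>
      have := lt_imageLength_zero k (0 + (k - 1))
      simp only [imageLength] at this ⊢
      omega
    | succ n =>
      have h1 := ih n (by omega)
      have h2 := imageLength_succ_zero k n
      have h3 := imageLength_succ_zero k (n + (k - 1))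
      have h4 : imageLength k (n + (k - 1)) 1 = imageLength k n 0 :=
        imageLength_add n one_ne_zero (by omega) (by omega)
      have h5 : n + 1 + (k - 1) = n + (k - 1) + 1 := by omega
      rw [h5]
      rcases lt_or_ge n (k - 1) with hn | hn
      · have h6 : imageLength k n 1 = 1 := imageLength_eq_one one_ne_zero (by omega)
        cases n with
        | zero =>
          have h7 := lt_imageLength_zero k (0 + (k - 1) + 1)
          simp only [imageLength] at h2 h7 ⊢
          simp
          simp at h7
          omega
        | succ n =>
          have h7 := lt_imageLength_zero k (n + 1)
          omega
      · have h6 := ih (n - (k - 1)) (by omega)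
        have h7 : imageLength k (n - (k - 1) + (k - 1)) 1 = imageLength k (n - (k - 1)) 0 :=
          imageLength_add _ one_ne_zero (by omega) (by omega)
        rw [Nat.sub_add_cancel hn] at h6 h7
        omega

/-! ### Blocks, neighbouring letters and orbits of letters. -/

namespace SelfSimilar

variable {k : ℕ} {x : ℕ → ℕ} {t : ℕ → Bool} {P : ℕ → ℕ}

theorem strictMono (h : SelfSimilar k x t P) : StrictMono P := by
  refine strictMono_nat_of_lt_succ fun i => ?_
  have := h.lt i
  by_cases h0 : x i = 0
  · have := (h.zero i h0).1
    omega
  · rcases lt_or_eq_of_le (show x i + 1 ≤ k by omega) with h1 | h1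
    · have := (h.mid i h0 h1).1
      omega
    · have := (h.last i h0 h1).1
      omega

theorem lt_map (h : SelfSimilar k x t P) {i : ℕ} (hi : 0 < i) : i < P i := by
  induction i, hi using Nat.le_induction with
  | base =>
    have := (h.zero 0 h.start).1
    have := h.map_zero
    simp_all
  | succ i _ ih =>
    have := h.strictMono (Nat.lt_succ_self i)
    simp only [Nat.succ_eq_add_one] at this ⊢
    omega

theorem map_succ_of_ne_zero (h : SelfSimilar k x t P) {i : ℕ} (h0 : x i ≠ 0) :
    P (i + 1) = P i + 1 := by
  have := h.lt i
  rcases lt_or_eq_of_le (show x i + 1 ≤ k by omega) with h1 | h1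
  · exact (h.mid i h0 h1).1
  · exact (h.last i h0 h1).1

theorem exists_block (h : SelfSimilar k x t P) (n : ℕ) :
    ∃ i, n = P i ∨ (x i = 0 ∧ n = P i + 1) := by
  induction n with
  | zero => exact ⟨0, .inl h.map_zero.symm⟩
  | succ n ih =>
    obtain ⟨i, hi | ⟨h0, hi⟩⟩ := ih
    · by_cases h0 : x i = 0
      · exact ⟨i, .inr ⟨h0, by omega⟩⟩
      · exact ⟨i + 1, .inl (by rw [h.map_succ_of_ne_zero h0, hi])⟩
    · exact ⟨i + 1, .inl (by rw [(h.zero i h0).1, hi])⟩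

theorem exists_map_eq (h : SelfSimilar k x t P) {n : ℕ} (hn : x n ≠ 1) : ∃ i, P i = n := by
  obtain ⟨i, hi | ⟨h0, hi⟩⟩ := h.exists_block n
  · exact ⟨i, hi.symm⟩
  · exact absurd (hi ▸ (h.zero i h0).2.2.2.1) hn

theorem index_map_eq_zero (h : SelfSimilar k x t P) {i : ℕ} (h0 : x i = 0) : x (P i) = 0 :=
  (h.zero i h0).2.1

/-- Every letter of index `l` is followed by a letter of index `0` or by the letter of index `l + 1`
with the same mark. -/
theorem index_succ (h : SelfSimilar k x t P) (n : ℕ) :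
    x (n + 1) = 0 ∨ (x (n + 1) = x n + 1 ∧ t (n + 1) = t n) := by
  induction n using Nat.strong_induction_on with
  | _ n ih =>
    obtain ⟨i, hi | ⟨h0, hi⟩⟩ := h.exists_block n
    · by_cases h0 : x i = 0
      · have := h.zero i h0
        rw [hi]
        right
        simp [this]
      · have hpos : 0 < i := Nat.pos_of_ne_zero fun hi0 => h0 (hi0 ▸ h.start)
        have hlt := h.lt_map hpos
        have hP := h.map_succ_of_ne_zero h0
        rw [hi, ← hP]
        rcases ih i (by omega) with h1 | ⟨h1, h2⟩
        · exact .inl (h.index_map_eq_zero h1)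
        · have h3 := h.lt (i + 1)
          have h4 := (h.mid i h0 (by omega)).2
          rcases lt_or_eq_of_le (show x (i + 1) + 1 ≤ k by omega) with h5 | h5
          · have h6 := (h.mid (i + 1) (by omega) h5).2
            right
            exact ⟨by omega, by rw [h6.2, h4.2, h2]⟩
          · exact .inl (h.last (i + 1) (by omega) h5).2.1
    · have hz := h.zero i h0
      have hle : i ≤ P i := h.strictMono.le_apply
      rw [show n + 1 = P (i + 1) by omega]
      rcases ih i (by omega) with h1 | ⟨h1, h2⟩
      · exact .inl (h.index_map_eq_zero h1)
      · have h3 := h.lt (i + 1)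
        rcases lt_or_eq_of_le (show x (i + 1) + 1 ≤ k by omega) with h5 | h5
        · have h6 := (h.mid (i + 1) (by omega) h5).2
          right
          rw [hi]
          exact ⟨by omega, by rw [h6.2, hz.2.2.2.2, h2]⟩
        · exact .inl (h.last (i + 1) (by omega) h5).2.1

theorem pred_of_index_ne_zero (h : SelfSimilar k x t P) {n : ℕ} (hn : x n ≠ 0) :
    0 < n ∧ x n = x (n - 1) + 1 ∧ t n = t (n - 1) := by
  have hpos : 0 < n := Nat.pos_of_ne_zero fun h0 => hn (h0 ▸ h.start)
  have := h.index_succ (n - 1)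
  rw [Nat.sub_add_cancel hpos] at this
  exact ⟨hpos, this.resolve_left hn⟩

/-- A letter of index `l` is preceded by the letters of indices `0, …, l - 1` with its mark. -/
theorem index_sub (h : SelfSimilar k x t P) {n : ℕ} (r : ℕ) (hr : r ≤ x n) :
    r ≤ n ∧ x (n - r) + r = x n ∧ t (n - r) = t n := by
  induction r with
  | zero => simp
  | succ r ih =>
    obtain ⟨h1, h2, h3⟩ := ih (by omega)
    obtain ⟨h4, h5, h6⟩ := h.pred_of_index_ne_zero (n := n - r) (by omega)
    rw [Nat.sub_sub] at h5 h6
    exact ⟨by omega, by omega, by rw [← h6, h3]⟩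

theorem iterate_map_succ (h : SelfSimilar k x t P) (n e : ℕ) :
    P^[n] (e + 1) = P^[n] e + imageLength k n (x e) := by
  induction n generalizing e with
  | zero => simp [imageLength]
  | succ n ih =>
    rw [Function.iterate_succ_apply, Function.iterate_succ_apply, imageLength]
    have := h.lt e
    by_cases h0 : x e = 0
    · have hz := h.zero e h0
      rw [if_pos h0, hz.1, show P e + 2 = P e + 1 + 1 by rfl, ih, ih, hz.2.1, hz.2.2.2.1, add_assoc]
    · rw [if_neg h0]
      rcases lt_or_eq_of_le (show x e + 1 ≤ k by omega) with h1 | h1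
      · have hm := h.mid e h0 h1
        rw [if_pos h1, hm.1, ih, hm.2.1]
      · have hm := h.last e h0 h1
        rw [if_neg (by omega), hm.1, ih, hm.2.1]

theorem iterate_zero (h : SelfSimilar k x t P) {e : ℕ} (h0 : x e = 0) (n : ℕ) :
    x (P^[n] e) = 0 ∧ t (P^[n] e) = t e := by
  induction n generalizing e with
  | zero => exact ⟨h0, rfl⟩
  | succ n ih =>
    have hz := h.zero e h0
    rw [Function.iterate_succ_apply, ← hz.2.2.1]
    exact ih hz.2.1

theorem iterate_mid (h : SelfSimilar k x t P) {e : ℕ} (h0 : x e ≠ 0) (n : ℕ) (hn : x e + n < k) :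
    x (P^[n] e) = x e + n ∧ t (P^[n] e) = t e := by
  induction n generalizing e with
  | zero => exact ⟨rfl, rfl⟩
  | succ n ih =>
    have hz := h.mid e h0 (by omega)
    rw [Function.iterate_succ_apply, ← hz.2.2]
    have := ih (e := P e) (by omega) (by omega)
    exact ⟨by omega, this.2⟩

theorem iterate_last (h : SelfSimilar k x t P) {e : ℕ} (h0 : x e ≠ 0) {n : ℕ} (hn : x e + n = k) :
    x (P^[n] e) = 0 ∧ t (P^[n] e) = !t e := by
  have hlt := h.lt e
  obtain ⟨m, rfl⟩ : ∃ m, n = m + 1 := ⟨n - 1, by omega⟩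
  have hm := h.iterate_mid h0 m (by omega)
  rw [Function.iterate_succ_apply', ← hm.2]
  exact (h.last _ (by omega) (by omega)).2

/-! ### Desubstitution of repeated letters. -/

/-- The letters at positions `a` and `b` coincide. -/
def Same (x : ℕ → ℕ) (t : ℕ → Bool) (a b : ℕ) : Prop := x a = x b ∧ t a = t b

theorem Same.symm {a b : ℕ} (h : Same x t a b) : Same x t b a := ⟨h.1.symm, h.2.symm⟩

/-- Position `P (i + 1) - 1` ends the block of `i`. This lets a disagreement on the left be pulled
back through the morphism. -/
theorem Same.map_last (h : SelfSimilar k x t P) {i j : ℕ} (hs : Same x t i j) :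
    Same x t (P (i + 1) - 1) (P (j + 1) - 1) := by
  obtain ⟨h1, h2⟩ := hs
  have := h.lt i
  by_cases h0 : x i = 0
  · have hi := h.zero i h0
    have hj := h.zero j (h1 ▸ h0)
    rw [hi.1, hj.1]
    exact ⟨hi.2.2.2.1.trans hj.2.2.2.1.symm, by
      rw [show P i + 2 - 1 = P i + 1 by omega, show P j + 2 - 1 = P j + 1 by omega,
        hi.2.2.2.2, hj.2.2.2.2, h2]⟩
  · rcases lt_or_eq_of_le (show x i + 1 ≤ k by omega) with h3 | h3
    · have hi := h.mid i h0 h3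
      have hj := h.mid j (h1 ▸ h0) (h1 ▸ h3)
      rw [hi.1, hj.1]
      exact ⟨by simp [hi, hj, h1], by simp [hi, hj, h2]⟩
    · have hi := h.last i h0 h3
      have hj := h.last j (h1 ▸ h0) (h1 ▸ h3)
      rw [hi.1, hj.1]
      exact ⟨by simp [hi, hj], by simp [hi, hj, h2]⟩

/-- Two positions whose letters differ but have images starting with the same letter. -/
def Merge (k : ℕ) (x : ℕ → ℕ) (t : ℕ → Bool) (a b : ℕ) : Prop :=
  x a = 0 ∧ x b + 1 = k ∧ t b = !t a

theorem same_or_merge (h : SelfSimilar k x t P) {i j : ℕ} (hs : Same x t (P i) (P j)) :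
    Same x t i j ∨ Merge k x t i j ∨ Merge k x t j i := by
  obtain ⟨h1, h2⟩ := hs
  have hi := h.lt i
  have hj := h.lt j
  unfold Same Merge
  by_cases hi0 : x i = 0 <;> by_cases hj0 : x j = 0
  · rw [(h.zero i hi0).2.2.1, (h.zero j hj0).2.2.1] at h2
    exact .inl ⟨by omega, h2⟩
  · rw [(h.zero i hi0).2.1] at h1
    rcases lt_or_eq_of_le (show x j + 1 ≤ k by omega) with h3 | h3
    · rw [(h.mid j hj0 h3).2.1] at h1
      omega
    · rw [(h.zero i hi0).2.2.1, (h.last j hj0 h3).2.2] at h2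
      exact .inr (.inl ⟨hi0, h3, by simp [h2]⟩)
  · rw [(h.zero j hj0).2.1] at h1
    rcases lt_or_eq_of_le (show x i + 1 ≤ k by omega) with h3 | h3
    · rw [(h.mid i hi0 h3).2.1] at h1
      omega
    · rw [(h.zero j hj0).2.2.1, (h.last i hi0 h3).2.2] at h2
      exact .inr (.inr ⟨hj0, h3, by simp [← h2]⟩)
  · left
    rcases lt_or_eq_of_le (show x i + 1 ≤ k by omega) with h3 | h3 <;>
    rcases lt_or_eq_of_le (show x j + 1 ≤ k by omega) with h4 | h4
    · have := h.mid i hi0 h3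
      have := h.mid j hj0 h4
      exact ⟨by omega, by simp_all⟩
    · have := h.mid i hi0 h3
      have := h.last j hj0 h4
      omega
    · have := h.last i hi0 h3
      have := h.mid j hj0 h4
      omega
    · have := h.last i hi0 h3
      have := h.last j hj0 h4
      exact ⟨by omega, by simp_all⟩

/-- Two occurrences of a letter that are preceded by different letters are, for some `n`, the first
letters of the `n`-th images of two letters that `Merge`. -/
theorem exists_merge (h : SelfSimilar k x t P) {s s' : ℕ} (hlt : s < s') (hs : Same x t s s')
    (hl : s = 0 ∨ ¬ Same x t (s - 1) (s' - 1)) :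
    ∃ n i j, i < j ∧ P^[n + 1] i = s ∧ P^[n + 1] j = s' ∧
      (Merge k x t i j ∨ Merge k x t j i) := by
  induction s' using Nat.strong_induction_on generalizing s with
  | _ s' ih =>
    -- A letter of index `1` has a forced predecessor, so both occurrences must start blocks.
    have h1 : x s ≠ 1 := by
      intro h1
      have ha := h.pred_of_index_ne_zero (n := s) (by omega)
      have hb := h.pred_of_index_ne_zero (n := s') (by rw [← hs.1]; omega)
      rcases hl with rfl | hl
      · omega
      · refine hl ⟨?_, ?_⟩
        · have := hs.1
          omega
        · rw [← ha.2.2, ← hb.2.2, hs.2]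
    obtain ⟨i, rfl⟩ := h.exists_map_eq h1
    obtain ⟨j, rfl⟩ := h.exists_map_eq (n := s') (hs.1 ▸ h1)
    have hij : i < j := h.strictMono.lt_iff_lt.1 hlt
    rcases h.same_or_merge hs with hs' | hm
    · have hl' : i = 0 ∨ ¬ Same x t (i - 1) (j - 1) := by
        rcases hl with h0 | hl
        · left
          by_contra hi
          have := h.lt_map (Nat.pos_of_ne_zero hi)
          omega
        · by_cases hi : i = 0
          · exact .inl hi
          · right
            intro hc
            apply hl
            have := hc.map_last h
            rwa [Nat.sub_add_cancel (by omega), Nat.sub_add_cancel (by omega)] at this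
      obtain ⟨n, a, b, hab, ha, hb, hm⟩ := ih j (h.lt_map (by omega)) hij hs' hl'
      exact ⟨n + 1, a, b, hab, by rw [Function.iterate_succ_apply', ha],
        by rw [Function.iterate_succ_apply', hb], hm⟩
    · exact ⟨0, i, j, hij, rfl, rfl, hm⟩

/-! ### Mismatches to the right of a merging pair. -/

/-- The image of `1` starts with a nonzero index until step `k - 1`, when it becomes `0'`; from then
on the first letters keep opposite marks. -/
theorem not_same_iterate (h : SelfSimilar k x t P) {e f : ℕ} (he : x e = 1) (hf : x f = 0)
    (htt : t e = t f) (n : ℕ) : ¬ Same x t (P^[n] e) (P^[n] f) := by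
  have hf' := h.iterate_zero hf
  have hk := h.lt e
  rintro ⟨h1, h2⟩
  rcases lt_or_ge (1 + n) k with hn | hn
  · have := h.iterate_mid (by omega) n (he ▸ hn)
    have := hf' n
    omega
  · obtain ⟨m, rfl⟩ : ∃ m, n = m + (k - 1) := ⟨n - (k - 1), by omega⟩
    have hl := h.iterate_last (e := e) (n := k - 1) (by omega) (by omega)
    have hz := h.iterate_zero hl.1 m
    rw [(hf' _).2, Function.iterate_add_apply, hz.2, hl.2, htt] at h2
    simp at h2

/-- For opposite marks and `n ≥ k - 1`, apply `ξ^(k-1)`: one side becomes a letter of index `0`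
followed by another of index `0`, the other a letter of index `0` followed by one of index `1`. Past
these first letters the same comparison recurs with the roles exchanged and `n` lowered by `k - 1`.
-/
theorem exists_not_same_iterate (hk : 3 ≤ k) (h : SelfSimilar k x t P) {e f : ℕ} (he : x e = 1)
    (hf : x f = 0) (n : ℕ) :
    ∃ d ≤ imageLength k n 0, ¬ Same x t (P^[n] e + d) (P^[n] f + d) := by
  induction n using Nat.strong_induction_on generalizing e f with
  | _ n ih =>
    by_cases htt : t e = t f
    · exact ⟨0, Nat.zero_le _, h.not_same_iterate he hf htt n⟩
    rcases lt_or_ge n (k - 1) with hn | hn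
    · refine ⟨0, Nat.zero_le _, fun hc => ?_⟩
      have h1 := h.iterate_mid (e := e) (by omega) n (by omega)
      have h2 := h.iterate_zero hf n
      have := hc.1
      simp only [add_zero] at this
      omega
    · obtain ⟨m, rfl⟩ : ∃ m, n = m + (k - 1) := ⟨n - (k - 1), by omega⟩
      have h1 := h.iterate_mid (e := e) (by omega) (k - 2) (by omega)
      have h2 := h.iterate_zero hf (k - 2)
      set a := P^[k - 2] e with ha
      set b := P^[k - 2] f with hb
      have ha' : P^[k - 1] e = P a := by
        rw [ha, ← Function.iterate_succ_apply' P, show (k - 2).succ = k - 1 by omega]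
      have hb' : P^[k - 1] f = P b := by
        rw [hb, ← Function.iterate_succ_apply' P, show (k - 2).succ = k - 1 by omega]
      have hla := h.last a (by omega) (by omega)
      have hsa : x (a + 1) = 0 := by
        have := h.lt (a + 1)
        exact (h.index_succ a).resolve_right (by omega)
      have hzb := h.zero b h2.1
      have hPa : x (P a + 1) = 0 := hla.1 ▸ h.index_map_eq_zero hsa
      obtain ⟨d, hd, hdd⟩ := ih m (by omega) hzb.2.2.2.1 hPa
      rw [h.iterate_map_succ, h.iterate_map_succ, hla.2.1, hzb.2.1] at hdd
      -- Skip the images of the two first letters; the doubling bound absorbs both summands.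
      refine ⟨imageLength k m 0 + d, ?_, ?_⟩
      · have := two_mul_imageLength_le hk m
        omega
      · rw [Function.iterate_add_apply, Function.iterate_add_apply, ha', hb', ← add_assoc,
          ← add_assoc]
        exact fun hc => hdd hc.symm

theorem exists_not_same_of_merge (hk : 3 ≤ k) (h : SelfSimilar k x t P) {i j : ℕ}
    (hm : Merge k x t i j) (n : ℕ) :
    ∃ d, ¬ Same x t (P^[n + 1] i + d) (P^[n + 1] j + d) ∧
      (d = imageLength k n 0 ∨ (x (j + 1) = 0 ∧ t (j + 1) = t j ∧ d ≤ 2 * imageLength k n 0)) := by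
  obtain ⟨h0, hl, ht⟩ := hm
  have hi := h.zero i h0
  have hj := h.last j (by omega) hl
  have hlt := h.lt (j + 1)
  have hsj : x (j + 1) = 0 := (h.index_succ j).resolve_right (by omega)
  have hs := h.zero (j + 1) hsj
  rw [hj.1] at hs
  have h1 := h.iterate_map_succ n (P i)
  have h2 := h.iterate_map_succ n (P j)
  rw [hi.2.1] at h1
  rw [hj.2.1] at h2
  simp only [Function.iterate_succ_apply]
  by_cases htt : t (j + 1) = t i
  · refine ⟨imageLength k n 0, ?_, .inl rfl⟩
    rw [← h1, ← h2]
    exact h.not_same_iterate hi.2.2.2.1 hs.2.1 (by rw [hi.2.2.2.2, hs.2.2.1, htt]) n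
  · obtain ⟨d, hd, hdd⟩ := h.exists_not_same_iterate hk hi.2.2.2.1 hs.2.1 n
    refine ⟨imageLength k n 0 + d, ?_, .inr ⟨hsj, ?_, by omega⟩⟩
    · rwa [← add_assoc, ← add_assoc, ← h1, ← h2]
    · rw [ht]
      exact Bool.eq_not_of_ne htt

theorem imageLength_le_iterate (h : SelfSimilar k x t P) {i j : ℕ} (hij : i < j) (n : ℕ) :
    P^[n] i + imageLength k n (x i) ≤ P^[n] j := by
  rw [← h.iterate_map_succ]
  exact (h.strictMono.iterate n).monotone hij

theorem imageLength_last (hk : 3 ≤ k) (n : ℕ) {l : ℕ} (hl : l + 1 = k) :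
    imageLength k (n + 1) l = imageLength k n 0 := by
  rw [imageLength, if_neg (by omega), if_neg (by omega)]

theorem exists_not_same_le (hk : 3 ≤ k) (h : SelfSimilar k x t P) {i j : ℕ} (hij : i < j)
    (hm : Merge k x t i j ∨ Merge k x t j i) (n : ℕ) :
    ∃ d, P^[n + 1] i + d ≤ P^[n + 1] j ∧ ¬ Same x t (P^[n + 1] i + d) (P^[n + 1] j + d) := by
  have hmono := imageLength_zero_le_succ k n
  have hp := h.imageLength_le_iterate hij (n + 1)
  rcases hm with hm | hm
  · obtain ⟨d, hd, hd' | ⟨-, -, hd'⟩⟩ := h.exists_not_same_of_merge hk hm n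
    · refine ⟨d, ?_, hd⟩
      rw [hm.1] at hp
      omega
    · refine ⟨d, ?_, hd⟩
      obtain ⟨h0, hl, ht⟩ := hm
      obtain ⟨h1, h2, h3⟩ := h.index_sub (n := j) (k - 1) (by omega)
      -- The run of indices `0, …, k - 1` ending at `j` carries one mark, opposite to that of `i`,
      -- so `i` lies before it. Two images of letters of index `0` then fit between the occurrences.
      have hij' : i < j - (k - 1) := by
        by_contra hc
        obtain ⟨-, h4, h5⟩ := h.index_sub (n := j) (j - i) (by omega)
        rw [Nat.sub_sub_self hij.le] at h5
        simp [h5] at ht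
      have h4 := h.imageLength_le_iterate hij' (n + 1)
      have h5 := h.imageLength_le_iterate (show j - (k - 1) < j by omega) (n + 1)
      rw [h0] at h4
      rw [show x (j - (k - 1)) = 0 by omega] at h5
      omega
  · obtain ⟨d, hd, hd' | ⟨h0, h1, hd'⟩⟩ := h.exists_not_same_of_merge hk hm n
    · refine ⟨d, ?_, fun hc => hd hc.symm⟩
      rw [imageLength_last hk n hm.2.1] at hp
      omega
    · refine ⟨d, ?_, fun hc => hd hc.symm⟩
      -- The letter after `i` has the mark of `i`, whereas `j` has the opposite one.
      have hij' : i + 1 < j := by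
        rcases lt_or_eq_of_le (Nat.succ_le_of_lt hij) with hlt | heq
        · exact hlt
        · have h2 := hm.2.2
          rw [← heq, Nat.succ_eq_add_one, h1] at h2
          simp at h2
      have h4 := h.imageLength_le_iterate hij' (n + 1)
      rw [h.iterate_map_succ, imageLength_last hk n hm.2.1, h0] at h4
      omega

/-- No factor of length `2 * p + 1` has period `p`. -/
theorem exists_not_same (hk : 3 ≤ k) (h : SelfSimilar k x t P) (s : ℕ) {p : ℕ} (hp : 0 < p) :
    ∃ d ≤ p, ¬ Same x t (s + d) (s + p + d) := by
  -- The induction slides the window left while the preceding letters agree.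
  induction s with
  | zero =>
    by_contra! hc
    obtain ⟨n, i, j, hij, hi, hj, hm⟩ :=
      h.exists_merge (s := 0) (s' := p) hp (by simpa using hc 0 (Nat.zero_le _)) (.inl rfl)
    obtain ⟨d, hd, hdd⟩ := h.exists_not_same_le hk hij hm n
    rw [hi, hj] at hdd hd
    exact hdd (by simpa using hc d (by omega))
  | succ s ih =>
    by_contra! hc
    by_cases hs : Same x t s (s + p)
    · obtain ⟨d, hd, hdd⟩ := ih
      cases d with
      | zero => exact hdd hs
      | succ d =>
        have := hc d (by omega)
        rw [show s + 1 + d = s + (d + 1) by omega,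
          show s + 1 + p + d = s + p + (d + 1) by omega] at this
        exact hdd this
    · obtain ⟨n, i, j, hij, hi, hj, hm⟩ :=
        h.exists_merge (s := s + 1) (s' := s + 1 + p) (by omega)
          (by simpa using hc 0 (Nat.zero_le _)) (.inr (by
            rwa [show s + 1 - 1 = s by omega, show s + 1 + p - 1 = s + p by omega]))
      obtain ⟨d, hd, hdd⟩ := h.exists_not_same_le hk hij hm n
      rw [hi, hj] at hdd hd
      exact hdd (hc d (by omega))

/-! ### Squares. -/

theorem Same.map (h : SelfSimilar k x t P) {i j : ℕ} (hs : Same x t i j) :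
    Same x t (P i) (P j) := by
  obtain ⟨h1, h2⟩ := hs
  have := h.lt i
  by_cases h0 : x i = 0
  · have hi := h.zero i h0
    have hj := h.zero j (h1 ▸ h0)
    exact ⟨by omega, by rw [hi.2.2.1, hj.2.2.1, h2]⟩
  · rcases lt_or_eq_of_le (show x i + 1 ≤ k by omega) with h3 | h3
    · have hi := h.mid i h0 h3
      have hj := h.mid j (h1 ▸ h0) (h1 ▸ h3)
      exact ⟨by omega, by rw [hi.2.2, hj.2.2, h2]⟩
    · have hi := h.last i h0 h3
      have hj := h.last j (h1 ▸ h0) (h1 ▸ h3)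
      exact ⟨by omega, by rw [hi.2.2, hj.2.2, h2]⟩

/-- Equal letters at positions `i` and `j` have equal `n`-th images. -/
theorem same_iterate (h : SelfSimilar k x t P) (n : ℕ) {i j : ℕ} (hs : Same x t i j) :
    ∀ d < imageLength k n (x i), Same x t (P^[n] i + d) (P^[n] j + d) := by
  induction n generalizing i j with
  | zero =>
    intro d hd
    simp only [imageLength, Nat.lt_one_iff] at hd
    subst hd
    exact hs
  | succ n ih =>
    intro d hd
    have hmap := ih (hs.map h)
    simp only [Function.iterate_succ_apply]
    rw [imageLength] at hd
    have := h.lt i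
    by_cases h0 : x i = 0
    · have hi := h.zero i h0
      have hj := h.zero j (hs.1 ▸ h0)
      rw [if_pos h0] at hd
      rw [hi.2.1] at hmap
      rcases lt_or_ge d (imageLength k n 0) with h1 | h1
      · exact hmap d h1
      · have h2 := ih (i := P i + 1) (j := P j + 1)
          ⟨hi.2.2.2.1.trans hj.2.2.2.1.symm, by rw [hi.2.2.2.2, hj.2.2.2.2, hs.2]⟩
          (d - imageLength k n 0) (by rw [hi.2.2.2.1]; omega)
        rw [h.iterate_map_succ, h.iterate_map_succ, hi.2.1, hj.2.1, add_assoc, add_assoc,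
          Nat.add_sub_cancel' h1] at h2
        exact h2
    · rw [if_neg h0] at hd
      rcases lt_or_eq_of_le (show x i + 1 ≤ k by omega) with h3 | h3
      · rw [if_pos h3, ← (h.mid i h0 h3).2.1] at hd
        exact hmap d hd
      · rw [if_neg (by omega), ← (h.last i h0 h3).2.1] at hd
        exact hmap d hd

theorem prefix_eq (h : SelfSimilar k x t P) {i : ℕ} (hi : i < k) :
    x i = i ∧ t i = t 0 ∧ (0 < i → P i = i + 1) := by
  induction i with
  | zero => exact ⟨h.start, rfl, fun h => absurd h (lt_irrefl _)⟩
  | succ i ih =>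
    obtain ⟨h1, h2, h3⟩ := ih (by omega)
    rcases Nat.eq_zero_or_pos i with rfl | hpos
    · have := h.zero 0 h.start
      simp only [h.map_zero, zero_add] at this ⊢
      exact ⟨this.2.2.2.1, this.2.2.2.2, fun _ => this.1⟩
    · have := h.mid i (by omega) (by omega)
      rw [h3 hpos] at this
      refine ⟨by omega, by rw [this.2.2, h2], fun _ => ?_⟩
      rw [h.map_succ_of_ne_zero (by omega), h3 hpos]

/-- There are squares of unbounded length. -/
theorem exists_square (h : SelfSimilar k x t P) (hk : 2 ≤ k) (n : ℕ) :
    ∃ s p, n < p ∧ ∀ d < p, Same x t (s + d) (s + p + d) := by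
  obtain ⟨h1, h2, h3⟩ := h.prefix_eq (i := k - 1) (by omega)
  have h3 := h3 (by omega)
  have hl := h.last (k - 1) (by omega) (by omega)
  rw [h3, Nat.sub_add_cancel (by omega)] at hl
  have hz := h.zero k hl.2.1
  rw [hl.1] at hz
  -- Positions `k` and `k + 1` carry the factor `0'0'`.
  have hs := h.same_iterate n (i := k) (j := k + 1)
    ⟨by rw [hl.2.1, hz.2.1], hz.2.2.1.symm⟩
  rw [h.iterate_map_succ, hl.2.1] at hs
  exact ⟨P^[n] k, imageLength k n 0, lt_imageLength_zero k n, hs⟩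

end SelfSimilar


/-! ### The word `u_k` as a self-similar sequence. -/

/-- A prefix of length `i` of `u_k` is a prefix of `ξ^i(0)`, so its image is a prefix of
`ξ^(i+1)(0)`. -/
theorem extend_prefix_fixedPoint (k : ℕ) [NeZero k] (i d : ℕ)
    (hd : d < (extend (xi k) ((List.range i).map (fixedPoint k))).length) :
    (extend (xi k) ((List.range i).map (fixedPoint k)))[d] = fixedPoint k d := by
  have hne : ∀ a, xi k a ≠ [] := by
    intro a
    unfold xi
    split_ifs <;> simp
  have hlen : i < ((extend (xi k))^[i] [zeroLetter k]).length :=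
    lt_length_iterate (xi k) hne (zeroLetter k) [(Fin.ofNat k 1, false)] (by simp)
      (by simp [xi, zeroLetter]) i
  have htake : (List.range i).map (fixedPoint k) =
      ((extend (xi k))^[i] [zeroLetter k]).take i := by
    refine List.ext_getElem (by simp [hlen.le]) fun j h1 h2 => ?_
    simp only [List.getElem_map, List.getElem_range, List.getElem_take]
    rw [getElem_iterate_xi_eq]
  have happ : (extend (xi k))^[i + 1] [zeroLetter k] =
      extend (xi k) ((List.range i).map (fixedPoint k)) ++
        extend (xi k) (((extend (xi k))^[i] [zeroLetter k]).drop i) := by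
    rw [Function.iterate_succ_apply', htake, ← extend_append, List.take_append_drop]
  rw [← getElem_iterate_xi_eq k (i + 1) d (by rw [happ, List.length_append]; omega)]
  simp only [happ, List.getElem_append_left hd]

/-- The position in `u_k` at which the image of the `i`-th letter starts. -/
def blockStart (k : ℕ) [NeZero k] (i : ℕ) : ℕ :=
  (extend (xi k) ((List.range i).map (fixedPoint k))).length

theorem extend_range_succ (k : ℕ) [NeZero k] (i : ℕ) :
    extend (xi k) ((List.range (i + 1)).map (fixedPoint k)) =
      extend (xi k) ((List.range i).map (fixedPoint k)) ++ xi k (fixedPoint k i) := by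
  rw [List.range_succ, List.map_append, extend_append]
  simp [extend]

theorem blockStart_succ (k : ℕ) [NeZero k] (i : ℕ) :
    blockStart k (i + 1) = blockStart k i + (xi k (fixedPoint k i)).length := by
  rw [blockStart, extend_range_succ, List.length_append, blockStart]

theorem fixedPoint_blockStart (k : ℕ) [NeZero k] (i d : ℕ)
    (hd : d < (xi k (fixedPoint k i)).length) :
    fixedPoint k (blockStart k i + d) = (xi k (fixedPoint k i))[d] := by
  rw [← extend_prefix_fixedPoint k (i + 1) (blockStart k i + d)
    (by rw [← blockStart, blockStart_succ]; omega)]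
  simp [extend_range_succ, blockStart]

theorem selfSimilar_fixedPoint {k : ℕ} [NeZero k] (hk : 2 ≤ k) :
    SelfSimilar k (fun i => (fixedPoint k i).1.val) (fun i => (fixedPoint k i).2)
      (blockStart k) where
  lt i := (fixedPoint k i).1.isLt
  start := by
    have := getElem_iterate_xi_eq k 0 0 (by simp)
    rw [← this]
    simp [zeroLetter]
  map_zero := by simp [blockStart, extend]
  zero i h0 := by
    have h1 := blockStart_succ k i
    have h2 := fixedPoint_blockStart k i
    have hx : xi k (fixedPoint k i) = [fixedPoint k i, (Fin.ofNat k 1, (fixedPoint k i).2)] := by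
      rw [xi, if_pos h0]
    simp only [hx] at h1 h2
    have h3 := h2 0 (by simp)
    have h4 := h2 1 (by simp)
    simp only [add_zero, List.getElem_cons_zero, List.getElem_cons_succ] at h3 h4
    refine ⟨h1, ?_, ?_, ?_, ?_⟩
    · rw [h3, h0]
    · rw [h3]
    · rw [h4]
      exact Nat.mod_eq_of_lt hk
    · rw [h4]
  mid i h0 hlt := by
    have h1 := blockStart_succ k i
    have h2 := fixedPoint_blockStart k i
    have hx : xi k (fixedPoint k i) =
        [(⟨(fixedPoint k i).1.val + 1, hlt⟩, (fixedPoint k i).2)] := by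
      rw [xi, if_neg h0, dif_pos hlt]
    simp only [hx] at h1 h2
    have h3 := h2 0 (by simp)
    simp only [add_zero, List.getElem_cons_zero] at h3
    refine ⟨h1, ?_, ?_⟩ <;> rw [h3]
  last i h0 hlt := by
    have h1 := blockStart_succ k i
    have h2 := fixedPoint_blockStart k i
    have hx : xi k (fixedPoint k i) = [(0, !(fixedPoint k i).2)] := by
      rw [xi, if_neg h0, dif_neg (by omega)]
    simp only [hx] at h1 h2
    have h3 := h2 0 (by simp)
    simp only [add_zero, List.getElem_cons_zero] at h3
    refine ⟨h1, ?_, ?_⟩ <;> rw [h3]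
    simp

theorem same_iff_fixedPoint_eq (k : ℕ) [NeZero k] (a b : ℕ) :
    SelfSimilar.Same (fun i => (fixedPoint k i).1.val) (fun i => (fixedPoint k i).2) a b ↔
      fixedPoint k a = fixedPoint k b := by
  rw [SelfSimilar.Same, Prod.ext_iff, Fin.ext_iff]

theorem exists_fixedPoint_ne {k : ℕ} [NeZero k] (hk : 3 ≤ k) (s : ℕ) {p : ℕ} (hp : 0 < p) :
    ∃ d ≤ p, fixedPoint k (s + d) ≠ fixedPoint k (s + p + d) := by
  obtain ⟨d, hd, h⟩ := (selfSimilar_fixedPoint (by omega)).exists_not_same hk s hp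
  exact ⟨d, hd, fun hc => h ((same_iff_fixedPoint_eq k _ _).2 hc)⟩

/-! ### Overlaps, square factors and critical exponents. -/

theorem not_isOverlap {k : ℕ} [NeZero k] (hk : 3 ≤ k) (w : List (Letter k))
    (hw : IsFactor w (fixedPoint k)) : ¬ IsOverlap w := by
  rintro ⟨a, y, rfl⟩
  obtain ⟨s, hs⟩ := hw
  obtain ⟨d, hd, hne⟩ := exists_fixedPoint_ne hk s (p := y.length + 1) (by omega)
  have h1 := hs d (by simp; omega)
  have h2 := hs (y.length + 1 + d) (by simp; omega)
  rw [add_assoc] at hne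
  refine hne (h1.symm.trans (Eq.trans ?_ h2))
  apply Option.some_injective
  rw [← List.getElem?_eq_getElem, ← List.getElem?_eq_getElem]
  have e1 : [a] ++ y ++ [a] ++ y ++ [a] = ([a] ++ y ++ [a]) ++ (y ++ [a]) := by simp
  have e2 : [a] ++ y ++ [a] ++ y ++ [a] = ([a] ++ y) ++ ([a] ++ y ++ [a]) := by simp
  conv_lhs => rw [e1, List.getElem?_append_left (by simp; omega)]
  conv_rhs => rw [e2, List.getElem?_append_right (by simp)]
  congr 1
  simp

theorem exists_square_factor {k : ℕ} [NeZero k] (hk : 2 ≤ k) (N : ℕ) :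
    ∃ y : List (Letter k), y ≠ [] ∧ N ≤ y.length ∧ IsFactor (y ++ y) (fixedPoint k) := by
  obtain ⟨s, p, hp, h⟩ := (selfSimilar_fixedPoint hk).exists_square hk N
  simp only [same_iff_fixedPoint_eq] at h
  refine ⟨(List.range p).map fun d => fixedPoint k (s + d), ?_, by simp [hp.le], s, ?_⟩
  · exact List.ne_nil_of_length_pos (by simp; omega)
  · intro i hi
    rw [List.getElem_append]
    split_ifs with h1
    · simp
    · simp only [List.length_append, List.length_map, List.length_range, not_lt] at hi h1
      simp only [List.length_map, List.length_range, List.getElem_map, List.getElem_range]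
      rw [h _ (by omega), add_assoc, Nat.add_sub_cancel' h1]

theorem le_two_of_mem_exponents {k : ℕ} [NeZero k] (hk : 3 ≤ k) {n : ℕ} {r : ℚ}
    (hr : r ∈ exponents (fixedPoint k) n) : r ≤ 2 := by
  obtain ⟨z, y, -, ⟨s, hs⟩, ⟨hy, hzy⟩, -, rfl⟩ := hr
  have hpos := List.length_pos_of_ne_nil hy
  rw [div_le_iff₀ (by exact_mod_cast hpos)]
  by_contra! hlt
  have hlt' : 2 * y.length < z.length := by exact_mod_cast hlt
  obtain ⟨d, hd, hne⟩ := exists_fixedPoint_ne hk s hpos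
  have h1 := hs d (by omega)
  have h2 := hs (y.length + d) (by omega)
  rw [add_assoc] at hne
  refine hne (h1.symm.trans (Eq.trans ?_ h2))
  apply Option.some_injective
  rw [← List.getElem?_eq_getElem, ← List.getElem?_eq_getElem, hzy _ (by omega),
    hzy _ (by omega), Nat.add_mod_left]

theorem two_mem_exponents {k : ℕ} [NeZero k] (hk : 2 ≤ k) (n : ℕ) :
    2 ∈ exponents (fixedPoint k) n := by
  obtain ⟨y, hy, hn, hf⟩ := exists_square_factor hk n
  have hpos := List.length_pos_of_ne_nil hy
  refine ⟨y ++ y, y, by simp [hy], hf, ⟨hy, fun i hi => ?_⟩, hn, ?_⟩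
  · rw [List.length_append] at hi
    rcases lt_or_ge i y.length with h | h
    · rw [List.getElem?_append_left h, Nat.mod_eq_of_lt h]
    · rw [List.getElem?_append_right h, Nat.mod_eq_sub_mod h, Nat.mod_eq_of_lt (by omega)]
  · have : (y.length : ℚ) ≠ 0 := by exact_mod_cast hpos.ne'
    rw [List.length_append, Nat.cast_add]
    field_simp
    norm_num

theorem extendedSup_exponents_fixedPoint {k : ℕ} [NeZero k] (hk : 3 ≤ k) (n : ℕ) :
    extendedSup (exponents (fixedPoint k) n) = 2 := by
  refine le_antisymm (iSup₂_le fun r hr => ?_) ?_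
  · have : ((r : ℚ) : ℝ) ≤ 2 := by exact_mod_cast le_two_of_mem_exponents hk hr
    exact EReal.coe_le_coe_iff.2 this
  · have := le_iSup₂ (f := fun (r : ℚ) (_ : r ∈ exponents (fixedPoint k) n) =>
      (((r : ℚ) : ℝ) : EReal)) 2 (two_mem_exponents (by omega) n)
    refine le_trans (le_of_eq ?_) this
    norm_num
    rfl

end ThueMorseLike

theorem mainTheorem3 (k : ℕ) [NeZero k] (hk : 4 ≤ k) :
    (∀ w : List (ThueMorseLike.Letter k),
        ThueMorseLike.IsFactor w (ThueMorseLike.fixedPoint k) → ¬ ThueMorseLike.IsOverlap w) ∧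
    (∀ N : ℕ, ∃ x : List (ThueMorseLike.Letter k), x ≠ [] ∧ N ≤ x.length ∧
        ThueMorseLike.IsFactor (x ++ x) (ThueMorseLike.fixedPoint k)) ∧
    ThueMorseLike.criticalExponent (ThueMorseLike.fixedPoint k) = 2 ∧
    ThueMorseLike.asymptoticCriticalExponent (ThueMorseLike.fixedPoint k) = 2 := by
  have hsup := ThueMorseLike.extendedSup_exponents_fixedPoint (k := k) (by omega)
  have hE : ThueMorseLike.criticalExponent (ThueMorseLike.fixedPoint k) = 2 := hsup 0
  refine ⟨ThueMorseLike.not_isOverlap (by omega),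
    ThueMorseLike.exists_square_factor (by omega), hE, ?_⟩
  have htop : (2 : EReal) ≠ ⊤ := EReal.coe_ne_top 2
  rw [ThueMorseLike.asymptoticCriticalExponent, if_neg (hE ▸ htop)]
  have hlim := ThueMorseLike.tendsto_extendedSup (ThueMorseLike.fixedPoint k)
  refine tendsto_nhds_unique hlim ?_
  simp only [hsup]
  exact tendsto_const_nhds
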